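/- Let $A$ be a real $n\times m$ matrix, let $\sigma_1(A)\ge\dots\ge\sigma_{\operatorname{rank}(A)}(A)>0$ be its nonzero singular values, and let $A^\dagger$ be its Moore-Penrose pseudo-inverse. For $S\subseteq\{1,\dots,m\}$ let $A_S$ be the submatrix of $A$ formed by the columns indexed by $S$, and let $\sigma_{\min}(B)=\min_{\|x\|_2=1}\|Bx\|_2$. Then for all integers $k,r$ with $1\le k\le r\le \operatorname{rank}(A)$ there exists a subset $S\subseteq\{1,\dots,m\}$ of size $k$ such that $$\sigma_{\min}(A_S)^2\ \ge\ \frac{(\sqrt r-\sqrt{k-1})^2}{m}\cdot\frac{r}{\sum_{i=1}^r\sigma_i(A)^{-2}}.$$ In particular, if $r=\operatorname{rank}(A)$, then $$\sigma_{\min}(A_S)^2\ \ge\ \frac{\bigl(\sqrt{\operatorname{rank}(A)}-\sqrt{k-1}\bigr)^2}{m}\cdot\frac{\operatorname{rank}(A)}{\|A^\dagger\|_F^2},$$ where $\|\cdot\|_F$ is the Frobenius norm. -/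

import Mathlib

open scoped Matrix Matrix.Norms.Frobenius

/-- `σ_min(B) = min_{‖x‖₂ = 1} ‖B x‖₂`, with Euclidean norms on both sides. The infimum is attained
as soon as `B` has at least one column, see `isLeast_sigmaMin`. -/
noncomputable def sigmaMin {n : ℕ} {ι : Type*} [Fintype ι] [DecidableEq ι]
    (B : Matrix (Fin n) ι ℝ) : ℝ :=
  sInf ((fun x : EuclideanSpace ℝ ι => ‖Matrix.toEuclideanLin B x‖) '' {x | ‖x‖ = 1})

theorem isLeast_sigmaMin {n : ℕ} {ι : Type*} [Fintype ι] [DecidableEq ι] [Nonempty ι]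
    (B : Matrix (Fin n) ι ℝ) :
    IsLeast ((fun x : EuclideanSpace ℝ ι => ‖Matrix.toEuclideanLin B x‖) '' {x | ‖x‖ = 1})
      (sigmaMin B) := by
  have hc : IsCompact {x : EuclideanSpace ℝ ι | ‖x‖ = 1} := by
    have h := isCompact_sphere (0 : EuclideanSpace ℝ ι) 1
    have e : Metric.sphere (0 : EuclideanSpace ℝ ι) 1 = {x | ‖x‖ = 1} := by
      ext x; simp
    rwa [e] at h
  have hne : ({x : EuclideanSpace ℝ ι | ‖x‖ = 1}).Nonempty := by
    obtain ⟨i⟩ := ‹Nonempty ι›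
    exact ⟨EuclideanSpace.single i 1, by simp⟩
  have hcont : Continuous (fun x : EuclideanSpace ℝ ι => ‖Matrix.toEuclideanLin B x‖) :=
    (LinearMap.continuous_of_finiteDimensional _).norm
  exact (hc.image hcont).isLeast_sInf (hne.image _)

/-- The submatrix `A_S` of the columns of `A` with index in `S`. -/
def columnSubmatrix {n m : ℕ} (A : Matrix (Fin n) (Fin m) ℝ) (S : Finset (Fin m)) :
    Matrix (Fin n) S ℝ :=
  A.submatrix id Subtype.val

/-- The nonincreasing sequence of singular values of `A`, indexed from `0`
(so the largest one is `sigma A 0`); the terms of index at least `A.rank` are zero. -/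
noncomputable def sigma {n m : ℕ} (A : Matrix (Fin n) (Fin m) ℝ) (i : ℕ) : ℝ :=
  (Matrix.toEuclideanLin A).singularValues i

/-- The four Penrose equations: `B` is the Moore-Penrose pseudo-inverse of the real matrix `A`. -/
structure IsMoorePenrose {n m : ℕ} (A : Matrix (Fin n) (Fin m) ℝ)
    (B : Matrix (Fin m) (Fin n) ℝ) : Prop where
  mul_mul_self : A * B * A = A
  self_mul_mul : B * A * B = B
  isSymm_left : (A * B).IsSymm
  isSymm_right : (B * A).IsSymm

theorem IsMoorePenrose.unique {n m : ℕ} {A : Matrix (Fin n) (Fin m) ℝ}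
    {B C : Matrix (Fin m) (Fin n) ℝ} (hB : IsMoorePenrose A B) (hC : IsMoorePenrose A C) :
    B = C := by
  have h1 : A * B = A * C := by
    calc A * B = (A * B)ᵀ := hB.isSymm_left.symm
      _ = ((A * C) * (A * B))ᵀ := by
          rw [← Matrix.mul_assoc (A * C) A B, hC.mul_mul_self]
      _ = (A * B) * (A * C) := by
          rw [Matrix.transpose_mul, hB.isSymm_left.eq, hC.isSymm_left.eq]
      _ = A * C := by rw [← Matrix.mul_assoc (A * B) A C, hB.mul_mul_self]
  have h2 : B * A = C * A := by
    calc B * A = (B * A)ᵀ := hB.isSymm_right.symm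
      _ = ((B * A) * (C * A))ᵀ := by
          rw [Matrix.mul_assoc B A (C * A), ← Matrix.mul_assoc A C A, hC.mul_mul_self]
      _ = (C * A) * (B * A) := by
          rw [Matrix.transpose_mul, hB.isSymm_right.eq, hC.isSymm_right.eq]
      _ = C * A := by rw [Matrix.mul_assoc C A (B * A), ← Matrix.mul_assoc A B A, hB.mul_mul_self]
  calc B = B * A * B := hB.self_mul_mul.symm
    _ = C * A * C := by rw [h2, Matrix.mul_assoc, h1, ← Matrix.mul_assoc]
    _ = C := hC.self_mul_mul

theorem exists_isMoorePenrose {n m : ℕ} (A : Matrix (Fin n) (Fin m) ℝ) :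
    ∃ B, IsMoorePenrose A B := by
  have hG : (Aᵀ * A).IsHermitian := by
    simpa [Matrix.conjTranspose_eq_transpose_of_trivial] using Matrix.isHermitian_conjTranspose_mul_self A
  obtain ⟨P, hPs, hGPG, hPGP, hcomm⟩ : ∃ P : Matrix (Fin m) (Fin m) ℝ,
      Pᵀ = P ∧ (Aᵀ * A) * P * (Aᵀ * A) = Aᵀ * A ∧ P * (Aᵀ * A) * P = P ∧
        P * (Aᵀ * A) = (Aᵀ * A) * P := by
    set U : Matrix (Fin m) (Fin m) ℝ := (hG.eigenvectorUnitary : Matrix (Fin m) (Fin m) ℝ)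
    set d := hG.eigenvalues
    have hU : Uᵀ * U = 1 := by
      have := Matrix.UnitaryGroup.star_mul_self hG.eigenvectorUnitary
      simpa [Matrix.star_eq_conjTranspose, Matrix.conjTranspose_eq_transpose_of_trivial] using this
    have hS : Aᵀ * A = U * Matrix.diagonal d * Uᵀ := by
      have := hG.spectral_theorem
      simpa [Unitary.conjStarAlgAut_apply, Matrix.star_eq_conjTranspose,
        Matrix.conjTranspose_eq_transpose_of_trivial, Function.comp_def] using this
    have key : ∀ a b : Fin m → ℝ, (U * Matrix.diagonal a * Uᵀ) * (U * Matrix.diagonal b * Uᵀ)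
        = U * Matrix.diagonal (fun i => a i * b i) * Uᵀ := by
      intro a b
      calc _ = U * Matrix.diagonal a * (Uᵀ * U) * Matrix.diagonal b * Uᵀ := by
            simp only [Matrix.mul_assoc]
        _ = _ := by rw [hU, Matrix.mul_one, Matrix.mul_assoc U, Matrix.diagonal_mul_diagonal]
    refine ⟨U * Matrix.diagonal (fun i => (d i)⁻¹) * Uᵀ, ?_, ?_, ?_, ?_⟩
    · simp [Matrix.transpose_mul, Matrix.mul_assoc]
    · rw [hS, key, key]; simp
    · rw [hS, key, key]; congr 3; ext i
      by_cases h : d i = 0 <;> simp [h]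
    · rw [hS, key, key]; simp [mul_comm]
  have hsymm : (P * (Aᵀ * A))ᵀ = P * (Aᵀ * A) := by
    rw [Matrix.transpose_mul, hPs, Matrix.transpose_mul, Matrix.transpose_transpose, hcomm]
  refine ⟨P * Aᵀ, ?_, ?_, ?_, ?_⟩
  · have h0 : A * (P * (Aᵀ * A) - 1) = 0 := by
      rw [← Matrix.conjTranspose_mul_self_eq_zero]
      rw [Matrix.conjTranspose_eq_transpose_of_trivial, Matrix.transpose_mul, Matrix.mul_assoc,
        ← Matrix.mul_assoc Aᵀ A, Matrix.mul_sub, ← Matrix.mul_assoc (Aᵀ * A) P, hGPG]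
      simp
    rw [Matrix.mul_sub, Matrix.mul_one, sub_eq_zero] at h0
    simpa [Matrix.mul_assoc] using h0
  · calc P * Aᵀ * A * (P * Aᵀ) = (P * (Aᵀ * A) * P) * Aᵀ := by simp only [Matrix.mul_assoc]
      _ = P * Aᵀ := by rw [hPGP]
  · simp [Matrix.IsSymm, Matrix.transpose_mul, hPs, Matrix.mul_assoc]
  · rw [Matrix.IsSymm, Matrix.mul_assoc, hsymm]

/-- The Moore-Penrose pseudo-inverse `A†`: the unique solution of the Penrose equations. -/
noncomputable def moorePenrose {n m : ℕ} (A : Matrix (Fin n) (Fin m) ℝ) :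
    Matrix (Fin m) (Fin n) ℝ :=
  (exists_isMoorePenrose A).choose

theorem isMoorePenrose_moorePenrose {n m : ℕ} (A : Matrix (Fin n) (Fin m) ℝ) :
    IsMoorePenrose A (moorePenrose A) :=
  (exists_isMoorePenrose A).choose_spec

/-! Columns are deleted one at a time, with a trace as barrier. Put `M = φ(AᵀA + c I)`, with `φ`,
`c` such that `tr M⁻¹ ≤ 1`. Each round subtracts `I` from the current principal submatrix, then
deletes one index. If `X` is the inverse after the subtraction, deleting `i` turns the trace of the
inverse into `tr X - (X²)ᵢᵢ / Xᵢᵢ`. Some `i` makes this at most 1, by averaging with weights `Xᵢᵢ`,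
provided `(tr X)² ≤ tr X + tr X²`; Cauchy-Schwarz derives that from the trace bound before the
subtraction. So the bound survives every round (`exists_finset_posDef_submatrix_sub`).

After `m - k` rounds, `M_S - (m - k) I` has inverse of trace at most 1, hence dominates `I`, and
`σ_min(A_S)² ≥ (m - k + 1)/φ - c`.

With `N = ∑_{i<r} σᵢ⁻²` and `s = r²/(r + cN)`, the choice `φ = (m - s)/c` is admissible
(`sum_inv_sq_sigma_add_le`) and gives `m σ_min(A_S)² ≥ c (s - (k - 1))`. Optimizing over `c` yields
the bound. -/

/-! ### Functional calculus through orthogonal diagonalization -/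

section SpectralDecomposition

variable {ι : Type*} [Fintype ι] [DecidableEq ι]

theorem Matrix.IsHermitian.exists_orthogonal_diagonalization {M : Matrix ι ι ℝ}
    (hM : M.IsHermitian) :
    ∃ U : Matrix ι ι ℝ, Uᵀ * U = 1 ∧ M = U * Matrix.diagonal hM.eigenvalues * Uᵀ := by
  refine ⟨(hM.eigenvectorUnitary : Matrix ι ι ℝ), ?_, ?_⟩
  · have := Matrix.UnitaryGroup.star_mul_self hM.eigenvectorUnitary
    simpa [Matrix.star_eq_conjTranspose, Matrix.conjTranspose_eq_transpose_of_trivial] using this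
  · have := hM.spectral_theorem
    simpa [Unitary.conjStarAlgAut_apply, Matrix.star_eq_conjTranspose,
      Matrix.conjTranspose_eq_transpose_of_trivial, Function.comp_def] using this

theorem orthogonal_conj_diagonal_mul {U : Matrix ι ι ℝ} (hU : Uᵀ * U = 1)
    (a b : ι → ℝ) :
    (U * Matrix.diagonal a * Uᵀ) * (U * Matrix.diagonal b * Uᵀ)
      = U * Matrix.diagonal (fun i => a i * b i) * Uᵀ := by
  calc _ = U * Matrix.diagonal a * (Uᵀ * U) * Matrix.diagonal b * Uᵀ := by
        simp only [Matrix.mul_assoc]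
    _ = _ := by rw [hU, Matrix.mul_one, Matrix.mul_assoc U, Matrix.diagonal_mul_diagonal]

theorem trace_orthogonal_conj_diagonal {U : Matrix ι ι ℝ} (hU : Uᵀ * U = 1)
    (a : ι → ℝ) :
    (U * Matrix.diagonal a * Uᵀ).trace = ∑ i, a i := by
  rw [Matrix.trace_mul_comm, ← Matrix.mul_assoc, hU, Matrix.one_mul, Matrix.trace_diagonal]

theorem orthogonal_conj_diagonal_const {U : Matrix ι ι ℝ} (hU : Uᵀ * U = 1)
    (c : ℝ) :
    U * Matrix.diagonal (fun _ => c) * Uᵀ = c • (1 : Matrix ι ι ℝ) := by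
  rw [← Matrix.smul_one_eq_diagonal, Matrix.mul_smul, Matrix.smul_mul, Matrix.mul_one,
    mul_eq_one_comm.mp hU]

theorem inv_orthogonal_conj_diagonal {U : Matrix ι ι ℝ} (hU : Uᵀ * U = 1)
    {a : ι → ℝ} (ha : ∀ i, a i ≠ 0) :
    (U * Matrix.diagonal a * Uᵀ)⁻¹ = U * Matrix.diagonal (fun i => (a i)⁻¹) * Uᵀ := by
  apply Matrix.inv_eq_right_inv
  rw [orthogonal_conj_diagonal_mul hU]
  simp only [mul_inv_cancel₀ (ha _)]
  simpa using orthogonal_conj_diagonal_const hU 1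

theorem posDef_orthogonal_conj_diagonal {U : Matrix ι ι ℝ} (hU : Uᵀ * U = 1)
    {a : ι → ℝ} (ha : ∀ i, 0 < a i) :
    (U * Matrix.diagonal a * Uᵀ).PosDef := by
  have h := (Matrix.PosDef.diagonal ha).mul_mul_conjTranspose_same (B := U)
    (Matrix.vecMul_injective_of_isUnit ((Matrix.isUnit_iff_isUnit_det _).mpr
      (Matrix.isUnit_det_of_left_inverse hU)))
  rwa [Matrix.conjTranspose_eq_transpose_of_trivial] at h

end SpectralDecomposition

/-! ### The barrier argument: shift by the identity, then delete an index -/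

section Barrier

variable {ι : Type*} [Fintype ι]

theorem exists_sub_div_diag_le_one [Nonempty ι] {X : Matrix ι ι ℝ} (hX : ∀ i, 0 < X i i)
    (h : X.trace ^ 2 ≤ X.trace + (X * X).trace) :
    ∃ i, X.trace - (X * X) i i / X i i ≤ 1 := by
  by_contra! hcon
  have h1 : ∑ i, X i i < ∑ i, (X i i * X.trace - (X * X) i i) :=
    Finset.sum_lt_sum_of_nonempty Finset.univ_nonempty fun i _ => by
      have h2 := mul_lt_mul_of_pos_left (hcon i) (hX i)
      rwa [mul_one, mul_sub, mul_div_cancel₀ _ (hX i).ne'] at h2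
  rw [Finset.sum_sub_distrib, ← Finset.sum_mul] at h1
  change X.trace < X.trace * X.trace - (X * X).trace at h1
  linarith [sq X.trace]

/-- Cauchy-Schwarz for the factorization `(d - 1)⁻² = ((d - 1)⁻¹ + (d - 1)⁻²) · d⁻¹`. -/
theorem sq_sum_inv_sub_one_le {d : ι → ℝ} (hd : ∀ i, 1 < d i) (hsum : ∑ i, (d i)⁻¹ ≤ 1) :
    (∑ i, (d i - 1)⁻¹) ^ 2 ≤ ∑ i, (d i - 1)⁻¹ + ∑ i, (d i - 1)⁻¹ * (d i - 1)⁻¹ := by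
  have hx : ∀ i, 0 < d i - 1 := fun i => sub_pos.mpr (hd i)
  have hpos : ∀ i, 0 ≤ (d i - 1)⁻¹ + (d i - 1)⁻¹ * (d i - 1)⁻¹ := fun i => by
    have := hx i
    positivity
  have h := Finset.sum_sq_le_sum_mul_sum_of_sq_le_mul Finset.univ
    (r := fun i => (d i - 1)⁻¹) (f := fun i => (d i - 1)⁻¹ + (d i - 1)⁻¹ * (d i - 1)⁻¹)
    (g := fun i => (d i)⁻¹) (fun i _ => hpos i)
    (fun i _ => inv_nonneg.mpr (zero_le_one.trans (hd i).le)) (fun i _ => by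
      have h1 := (hx i).ne'
      have h2 : d i ≠ 0 := (zero_lt_one.trans (hd i)).ne'
      refine le_of_eq ?_
      field_simp
      ring)
  rw [← Finset.sum_add_distrib]
  exact h.trans (mul_le_of_le_one_right (Finset.sum_nonneg fun i _ => hpos i) hsum)

variable [DecidableEq ι]

/-- Subtracting the identity from a positive definite matrix with `tr M⁻¹ ≤ 1`. -/
theorem Matrix.PosDef.sub_one_of_trace_inv_le_one {M : Matrix ι ι ℝ} (hM : M.PosDef)
    (hι : 2 ≤ Fintype.card ι) (htr : M⁻¹.trace ≤ 1) :
    (M - 1).PosDef ∧ (M - 1)⁻¹.trace ^ 2 ≤ (M - 1)⁻¹.trace + ((M - 1)⁻¹ * (M - 1)⁻¹).trace := by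
  obtain ⟨U, hU, hMU⟩ := hM.isHermitian.exists_orthogonal_diagonalization
  have hd0 : ∀ i, 0 < hM.isHermitian.eigenvalues i := hM.eigenvalues_pos
  generalize hM.isHermitian.eigenvalues = d at hMU hd0
  rw [hMU, inv_orthogonal_conj_diagonal hU fun i => (hd0 i).ne',
    trace_orthogonal_conj_diagonal hU] at htr
  -- A second eigenvalue makes `(d i)⁻¹` strictly smaller than the trace. In dimension one, `M = 1`
  -- satisfies the trace bound but `M - 1` is singular.
  have hd : ∀ i, 1 < d i := fun i => by
    have : Nontrivial ι := Fintype.one_lt_card_iff_nontrivial.mp hι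
    obtain ⟨j, hj⟩ := exists_ne i
    have h1 : (d i)⁻¹ < ∑ i, (d i)⁻¹ := Finset.single_lt_sum hj (Finset.mem_univ i)
      (Finset.mem_univ j) (inv_pos.mpr (hd0 j)) fun l _ _ => (inv_pos.mpr (hd0 l)).le
    exact (inv_lt_one₀ (hd0 i)).mp (h1.trans_le htr)
  have hsub : M - 1 = U * Matrix.diagonal (fun i => d i - 1) * Uᵀ := by
    have h1 := orthogonal_conj_diagonal_const hU 1
    rw [one_smul] at h1
    rw [← Matrix.diagonal_sub, Matrix.mul_sub, Matrix.sub_mul, ← hMU, h1]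
  rw [hsub, inv_orthogonal_conj_diagonal hU fun i => (sub_pos.mpr (hd i)).ne',
    orthogonal_conj_diagonal_mul hU, trace_orthogonal_conj_diagonal hU,
    trace_orthogonal_conj_diagonal hU]
  exact ⟨posDef_orthogonal_conj_diagonal hU fun i => sub_pos.mpr (hd i),
    sq_sum_inv_sub_one_le hd htr⟩

theorem Matrix.PosDef.dotProduct_self_le_of_trace_inv_le_one {M : Matrix ι ι ℝ} (hM : M.PosDef)
    (htr : M⁻¹.trace ≤ 1) (x : ι → ℝ) : x ⬝ᵥ x ≤ x ⬝ᵥ M *ᵥ x := by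
  obtain ⟨U, hU, hMU⟩ := hM.isHermitian.exists_orthogonal_diagonalization
  have hd0 : ∀ i, 0 < hM.isHermitian.eigenvalues i := hM.eigenvalues_pos
  generalize hM.isHermitian.eigenvalues = d at hMU hd0
  rw [hMU, inv_orthogonal_conj_diagonal hU fun i => (hd0 i).ne',
    trace_orthogonal_conj_diagonal hU] at htr
  have hd : ∀ i, 1 ≤ d i := fun i =>
    (inv_le_one₀ (hd0 i)).mp <| (Finset.single_le_sum (f := fun i => (d i)⁻¹)
      (fun l _ => (inv_pos.mpr (hd0 l)).le) (Finset.mem_univ i)).trans htr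
  have hsub : M - 1 = U * Matrix.diagonal (fun i => d i - 1) * Uᵀ := by
    have h1 := orthogonal_conj_diagonal_const hU 1
    rw [one_smul] at h1
    rw [← Matrix.diagonal_sub, Matrix.mul_sub, Matrix.sub_mul, ← hMU, h1]
  have hpsd : (M - 1).PosSemidef := by
    have h := (Matrix.PosSemidef.diagonal (d := fun i => d i - 1)
      fun i => sub_nonneg.mpr (hd i)).mul_mul_conjTranspose_same U
    rwa [Matrix.conjTranspose_eq_transpose_of_trivial, ← hsub] at h
  have h := hpsd.dotProduct_mulVec_nonneg x
  rw [star_trivial, Matrix.sub_mulVec, Matrix.one_mulVec, dotProduct_sub] at h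
  linarith

/-- The trace of the inverse of a principal submatrix of codimension one. -/
theorem trace_inv_submatrix_compl_singleton {κ : Type*} [Fintype κ] [DecidableEq κ]
    {N : Matrix ι ι ℝ} (hN : N.PosDef) {f : κ → ι} (hf : Function.Injective f) {i : ι}
    (hi : ∀ j, j ∈ Set.range f ↔ j ≠ i) :
    (N.submatrix f f)⁻¹.trace = N⁻¹.trace - (N⁻¹ * N⁻¹) i i / N⁻¹ i i := by
  set X := N⁻¹ with hX
  have hXpos : 0 < X i i := hN.inv.diag_pos
  have hXsymm : ∀ a b, X a b = X b a := fun a b => by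
    simpa using hN.inv.isHermitian.apply b a
  have hNX : N * X = 1 := Matrix.mul_nonsing_inv _ ((Matrix.isUnit_iff_isUnit_det _).mp hN.isUnit)
  have hsum : ∀ g : ι → ℝ, g i + ∑ c : κ, g (f c) = ∑ j, g j := fun g => by
    rw [← Finset.add_sum_erase _ _ (Finset.mem_univ i), ← Finset.sum_image (f := g) hf.injOn]
    congr 2
    ext j
    simp only [Finset.mem_image, Finset.mem_univ, true_and, Finset.mem_erase, and_true]
    exact hi j
  have hne : ∀ a, f a ≠ i := fun a => (hi _).mp ⟨a, rfl⟩
  -- The inverse of the submatrix is the Schur complement of `X i i` in `X`. Its formula vanishes at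
  -- the index `i`, so sums over `κ` extend to all of `ι`.
  have hinv : (N.submatrix f f)⁻¹
      = Matrix.of fun a b => X (f a) (f b) - X (f a) i * X i (f b) / X i i := by
    apply Matrix.inv_eq_right_inv
    ext a b
    have h1 := hsum fun c => N (f a) c * (X c (f b) - X c i * X i (f b) / X i i)
    rw [mul_div_cancel_left₀ _ hXpos.ne', sub_self, mul_zero, zero_add] at h1
    have h2 : ∑ c, N (f a) c * (X c (f b) - X c i * X i (f b) / X i i)
        = (N * X) (f a) (f b) - (N * X) (f a) i * (X i (f b) / X i i) := by
      rw [Matrix.mul_apply, Matrix.mul_apply, Finset.sum_mul, ← Finset.sum_sub_distrib]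
      exact Finset.sum_congr rfl fun c _ => by ring
    rw [hNX, Matrix.one_apply_ne (hne a), zero_mul, sub_zero] at h2
    rw [Matrix.mul_apply]
    simp only [Matrix.submatrix_apply, Matrix.of_apply]
    rw [h1, h2, Matrix.one_apply, Matrix.one_apply]
    simp only [hf.eq_iff]
  rw [hinv, Matrix.trace, Matrix.trace]
  simp only [Matrix.diag_apply, Matrix.of_apply]
  have h3 := hsum fun c => X c c - X c i * X i c / X i i
  rw [mul_div_cancel_left₀ _ hXpos.ne', sub_self, zero_add] at h3
  rw [h3, Finset.sum_sub_distrib, Matrix.mul_apply, Finset.sum_div]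
  congr 1
  exact Finset.sum_congr rfl fun c _ => by rw [mul_comm]

theorem exists_finset_posDef_submatrix_sub {M : Matrix ι ι ℝ} (hM : M.PosDef)
    (htr : M⁻¹.trace ≤ 1) (j : ℕ) (hj : j < Fintype.card ι) :
    ∃ S : Finset ι, S.card + j = Fintype.card ι ∧
      ((M - (j : ℝ) • 1).submatrix ((↑) : S → ι) (↑)).PosDef ∧
      ((M - (j : ℝ) • 1).submatrix ((↑) : S → ι) (↑))⁻¹.trace ≤ 1 := by
  induction j with
  | zero =>
    refine ⟨Finset.univ, by simp, ?_, ?_⟩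
    · simpa using hM.submatrix Subtype.val_injective
    · let e : ↥(Finset.univ : Finset ι) ≃ ι := Equiv.subtypeUnivEquiv Finset.mem_univ
      have h : (M - ((0 : ℕ) : ℝ) • 1).submatrix ((↑) : ↥(Finset.univ : Finset ι) → ι) (↑)
          = M.submatrix e e := by
        ext a b
        simp [e]
      rw [h, Matrix.inv_submatrix_equiv, Matrix.trace]
      exact (e.sum_comp fun a => M⁻¹ a a).trans_le htr
  | succ j ih =>
    obtain ⟨S, hS, hpd, htrS⟩ := ih (by omega)
    have hcard : 2 ≤ Fintype.card S := by
      rw [Fintype.card_coe]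
      omega
    obtain ⟨hpd', hineq⟩ := hpd.sub_one_of_trace_inv_le_one hcard htrS
    have : Nonempty S := Fintype.card_pos_iff.mp (by omega)
    obtain ⟨i, hi⟩ := exists_sub_div_diag_le_one (fun i => hpd'.inv.diag_pos (i := i)) hineq
    let f : (S.erase (i : ι) : Finset ι) → S := fun a => ⟨a, Finset.mem_of_mem_erase a.2⟩
    have hf : Function.Injective f := fun a b hab => Subtype.ext (congrArg (fun s : S => (s : ι)) hab)
    have hrange : ∀ b, b ∈ Set.range f ↔ b ≠ i := fun b => by
      constructor
      · rintro ⟨a, rfl⟩ h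
        exact Finset.ne_of_mem_erase a.2 (congrArg (fun s : S => (s : ι)) h)
      · intro h
        exact ⟨⟨b, Finset.mem_erase.mpr ⟨fun h' => h (Subtype.ext h'), b.2⟩⟩, rfl⟩
    have hsub : (M - ((j + 1 : ℕ) : ℝ) • 1).submatrix
        ((↑) : (S.erase (i : ι) : Finset ι) → ι) (↑)
        = ((M - (j : ℝ) • 1).submatrix ((↑) : S → ι) (↑) - 1).submatrix f f := by
      ext a b
      simp only [Matrix.submatrix_apply, Matrix.sub_apply, Matrix.smul_apply, smul_eq_mul, f,
        Matrix.one_apply, Subtype.mk.injEq]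
      push_cast
      ring
    refine ⟨S.erase i, ?_, ?_, ?_⟩
    · have := Finset.card_erase_add_one i.2
      omega
    · rw [hsub]
      exact hpd'.submatrix hf
    · rw [hsub, trace_inv_submatrix_compl_singleton hpd' hf hrange]
      exact hi

end Barrier

/-! ### Singular values as eigenvalues of the Gram matrix -/

section SingularValues

variable {n m : ℕ} (A : Matrix (Fin n) (Fin m) ℝ)

theorem isHermitian_transpose_mul_self : (Aᵀ * A).IsHermitian := by
  simpa [Matrix.conjTranspose_eq_transpose_of_trivial] using
    Matrix.isHermitian_conjTranspose_mul_self A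

theorem adjoint_comp_toEuclideanLin :
    (Matrix.toEuclideanLin A).adjoint ∘ₗ Matrix.toEuclideanLin A
      = Matrix.toEuclideanLin (Aᵀ * A) := by
  rw [← Matrix.toEuclideanLin_conjTranspose_eq_adjoint,
    Matrix.conjTranspose_eq_transpose_of_trivial]
  ext x i
  simp [Matrix.toLpLin_apply]

/-- Both multisets consist of the roots of the same characteristic polynomial; comparing multisets
avoids matching the two orderings. -/
theorem map_sq_sigma_eq_map_eigenvalues :
    (Finset.univ : Finset (Fin m)).val.map (fun i : Fin m => sigma A i ^ 2)
      = (Finset.univ : Finset (Fin m)).val.map (isHermitian_transpose_mul_self A).eigenvalues := by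
  have hsymm := (Matrix.toEuclideanLin A).isSymmetric_adjoint_comp_self
  have hfin : Module.finrank ℝ (EuclideanSpace ℝ (Fin m)) = m := finrank_euclideanSpace_fin
  have h1 := hsymm.roots_charpoly_eq_eigenvalues hfin
  have h2 := (isHermitian_transpose_mul_self A).roots_charpoly_eq_eigenvalues
  have h3 : ((Matrix.toEuclideanLin A).adjoint ∘ₗ Matrix.toEuclideanLin A).charpoly
      = (Aᵀ * A).charpoly := by
    rw [adjoint_comp_toEuclideanLin, Matrix.toEuclideanLin, Matrix.toLpLin_eq_toLin, Matrix.charpoly_toLin]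
  rw [h3, h2] at h1
  simp only [sigma, (Matrix.toEuclideanLin A).sq_singularValues_fin hfin]
  exact h1.symm

theorem sum_eigenvalues_eq_sum_sigma (F : ℝ → ℝ) :
    ∑ j, F ((isHermitian_transpose_mul_self A).eigenvalues j)
      = ∑ i ∈ Finset.range m, F (sigma A i ^ 2) := by
  rw [Finset.sum_range]
  have h := congrArg (fun s => (s.map F).sum) (map_sq_sigma_eq_map_eigenvalues A)
  simpa [Multiset.map_map, Function.comp_def, Finset.sum] using h.symm

theorem finrank_range_toEuclideanLin :
    Module.finrank ℝ (LinearMap.range (Matrix.toEuclideanLin A)) = A.rank := by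
  rw [Matrix.toEuclideanLin, Matrix.toLpLin_eq_toLin]
  exact (Matrix.rank_eq_finrank_range_toLin A _ _).symm

theorem sigma_pos_iff {i : ℕ} : 0 < sigma A i ↔ i < A.rank := by
  rw [← finrank_range_toEuclideanLin]
  exact LinearMap.singularValues_pos_iff_lt_finrank_range _

end SingularValues

/-! ### Frobenius norm of the pseudo-inverse -/

section PseudoInverse

variable {n m : ℕ} {A : Matrix (Fin n) (Fin m) ℝ}

theorem frobenius_norm_sq_eq_trace {p q : ℕ} (B : Matrix (Fin p) (Fin q) ℝ) :
    ‖B‖ ^ 2 = (B * Bᵀ).trace := by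
  rw [Matrix.frobenius_norm_def, ← Real.sqrt_eq_rpow, Real.sq_sqrt (by positivity)]
  simp [Matrix.trace, Matrix.mul_apply, sq]

theorem IsMoorePenrose.mul_transpose_mul {B : Matrix (Fin m) (Fin n) ℝ}
    (h : IsMoorePenrose A B) : (B * Bᵀ) * (Aᵀ * A) = B * A := by
  calc (B * Bᵀ) * (Aᵀ * A) = B * (A * B)ᵀ * A := by
        rw [Matrix.transpose_mul]; simp only [Matrix.mul_assoc]
    _ = (B * A * B) * A := by rw [h.isSymm_left.eq]; simp only [Matrix.mul_assoc]
    _ = B * A := by rw [h.self_mul_mul]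

theorem IsMoorePenrose.mul_mul_gram {B : Matrix (Fin m) (Fin n) ℝ}
    (h : IsMoorePenrose A B) : (B * A) * (Aᵀ * A) = Aᵀ * A := by
  have h1 : (Aᵀ * A) * (B * A) = Aᵀ * A := by
    rw [Matrix.mul_assoc, ← Matrix.mul_assoc A, h.mul_mul_self]
  have h2 := congrArg Matrix.transpose h1
  rwa [Matrix.transpose_mul, h.isSymm_right.eq, Matrix.transpose_mul,
    Matrix.transpose_transpose] at h2

/-- In an eigenbasis of `AᵀA`, the diagonal entry of `B Bᵀ` is `(d j)⁻¹` where `d j ≠ 0`. Elsewhere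
it is nonnegative, while `0⁻¹ = 0`. -/
theorem IsMoorePenrose.sum_inv_eigenvalues_le {B : Matrix (Fin m) (Fin n) ℝ}
    (h : IsMoorePenrose A B) :
    ∑ j, ((isHermitian_transpose_mul_self A).eigenvalues j)⁻¹ ≤ ‖B‖ ^ 2 := by
  obtain ⟨U, hU, hG⟩ := (isHermitian_transpose_mul_self A).exists_orthogonal_diagonalization
  generalize (isHermitian_transpose_mul_self A).eigenvalues = d at hG
  have hGU : (Aᵀ * A) * U = U * Matrix.diagonal d := by
    rw [hG, Matrix.mul_assoc, hU, Matrix.mul_one]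
  have hUU : U * Uᵀ = 1 := mul_eq_one_comm.mp hU
  set C := Uᵀ * (B * Bᵀ) * U with hC
  have htr : ‖B‖ ^ 2 = C.trace := by
    rw [frobenius_norm_sq_eq_trace, hC, Matrix.trace_mul_comm (Uᵀ * (B * Bᵀ)), ← Matrix.mul_assoc,
      hUU, Matrix.one_mul]
  have hpsd : C.PosSemidef := by
    have h1 := (Matrix.posSemidef_self_mul_conjTranspose B).conjTranspose_mul_mul_same U
    rwa [Matrix.conjTranspose_eq_transpose_of_trivial,
      Matrix.conjTranspose_eq_transpose_of_trivial] at h1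
  have hkey : C * Matrix.diagonal d * Matrix.diagonal d = Matrix.diagonal d := by
    calc C * Matrix.diagonal d * Matrix.diagonal d
        = Uᵀ * ((B * Bᵀ) * ((Aᵀ * A) * ((Aᵀ * A) * U))) := by
          rw [hGU, ← Matrix.mul_assoc (Aᵀ * A), hGU, hC]; simp only [Matrix.mul_assoc]
      _ = Uᵀ * ((B * A) * (Aᵀ * A) * U) := by
          rw [← h.mul_transpose_mul]; simp only [Matrix.mul_assoc]
      _ = Matrix.diagonal d := by
          rw [h.mul_mul_gram, hGU, ← Matrix.mul_assoc, hU, Matrix.one_mul]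
  rw [htr]
  refine Finset.sum_le_sum fun j _ => ?_
  rcases eq_or_ne (d j) 0 with hd | hd
  · rw [hd, inv_zero]
    exact hpsd.diag_nonneg
  · have h1 := congrFun (congrFun hkey j) j
    rw [Matrix.mul_diagonal, Matrix.mul_diagonal, Matrix.diagonal_apply_eq] at h1
    have h2 : C j j * d j = 1 := mul_right_cancel₀ hd (h1.trans (one_mul _).symm)
    exact (eq_inv_of_mul_eq_one_left h2).ge

theorem sum_inv_sq_sigma_le_frobenius_norm_sq :
    ∑ i ∈ Finset.range A.rank, (sigma A i ^ 2)⁻¹ ≤ ‖moorePenrose A‖ ^ 2 := by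
  refine le_trans ?_ (isMoorePenrose_moorePenrose A).sum_inv_eigenvalues_le
  rw [sum_eigenvalues_eq_sum_sigma A fun x => x⁻¹]
  exact Finset.sum_le_sum_of_subset_of_nonneg
    (Finset.range_subset_range.mpr (A.rank_le_width)) fun i _ _ => by positivity

end PseudoInverse

/-! ### From the barrier to a column subset -/

section ColumnSelection

variable {n m : ℕ} (A : Matrix (Fin n) (Fin m) ℝ)

theorem norm_sq_toEuclideanLin_columnSubmatrix (S : Finset (Fin m)) (x : EuclideanSpace ℝ S) :
    ‖Matrix.toEuclideanLin (columnSubmatrix A S) x‖ ^ 2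
      = x.ofLp ⬝ᵥ (Aᵀ * A).submatrix ((↑) : S → Fin m) (↑) *ᵥ x.ofLp := by
  have h : (Aᵀ * A).submatrix ((↑) : S → Fin m) (↑)
      = (columnSubmatrix A S)ᵀ * columnSubmatrix A S := by
    ext a b
    simp [columnSubmatrix, Matrix.mul_apply]
  rw [h, ← Matrix.mulVec_mulVec, Matrix.dotProduct_mulVec, Matrix.vecMul_transpose,
    EuclideanSpace.norm_sq_eq, dotProduct]
  simp [Matrix.toLpLin_apply, sq]

/-- Column selection from a bound on the trace of the resolvent of the Gram matrix. -/
theorem exists_finset_le_sigmaMin_sq {c φ : ℝ} (hc : 0 < c) (hφ : 0 < φ)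
    (hsum : ∑ i ∈ Finset.range m, (sigma A i ^ 2 + c)⁻¹ ≤ φ) {k : ℕ} (hk : 1 ≤ k) (hkm : k ≤ m) :
    ∃ S : Finset (Fin m), S.card = k ∧
      ((m : ℝ) - k + 1) / φ - c ≤ sigmaMin (columnSubmatrix A S) ^ 2 := by
  obtain ⟨U, hU, hG⟩ := (isHermitian_transpose_mul_self A).exists_orthogonal_diagonalization
  have hd0 : ∀ i, 0 ≤ (isHermitian_transpose_mul_self A).eigenvalues i := by
    have h := Matrix.posSemidef_conjTranspose_mul_self A
    rw [Matrix.conjTranspose_eq_transpose_of_trivial] at h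
    exact h.eigenvalues_nonneg
  rw [← sum_eigenvalues_eq_sum_sigma A fun x => (x + c)⁻¹] at hsum
  generalize (isHermitian_transpose_mul_self A).eigenvalues = d at hG hd0 hsum
  have hpos : ∀ i, 0 < φ * (d i + c) := fun i => mul_pos hφ (add_pos_of_nonneg_of_pos (hd0 i) hc)
  have hM : φ • (Aᵀ * A + c • (1 : Matrix (Fin m) (Fin m) ℝ))
      = U * Matrix.diagonal (fun i => φ * (d i + c)) * Uᵀ := by
    have h1 := orthogonal_conj_diagonal_const hU c
    have h2 : Matrix.diagonal (fun i => φ * (d i + c))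
        = φ • (Matrix.diagonal d + Matrix.diagonal fun _ => c) := by
      rw [Matrix.diagonal_add, ← Matrix.diagonal_smul]
      rfl
    rw [h2, Matrix.mul_smul, Matrix.smul_mul, Matrix.mul_add, Matrix.add_mul, ← hG, h1]
  have hMpd : (φ • (Aᵀ * A + c • (1 : Matrix (Fin m) (Fin m) ℝ))).PosDef := by
    rw [hM]
    exact posDef_orthogonal_conj_diagonal hU hpos
  have hMtr : (φ • (Aᵀ * A + c • (1 : Matrix (Fin m) (Fin m) ℝ)))⁻¹.trace ≤ 1 := by
    rw [hM, inv_orthogonal_conj_diagonal hU fun i => (hpos i).ne',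
      trace_orthogonal_conj_diagonal hU]
    simp only [mul_inv]
    rw [← Finset.mul_sum, inv_mul_le_one₀ hφ]
    exact hsum
  obtain ⟨S, hS, hpd, htr⟩ := exists_finset_posDef_submatrix_sub hMpd hMtr (m - k)
    (by rw [Fintype.card_fin]; omega)
  rw [Fintype.card_fin] at hS
  have hSk : S.card = k := by omega
  refine ⟨S, hSk, ?_⟩
  have : Nonempty S := Finset.Nonempty.to_subtype (Finset.card_pos.mp (by omega))
  obtain ⟨x, hx1, hx⟩ := (isLeast_sigmaMin (columnSubmatrix A S)).1
  rw [← hx]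
  simp only
  have hquad := hpd.dotProduct_self_le_of_trace_inv_le_one htr x.ofLp
  have hxx : x.ofLp ⬝ᵥ x.ofLp = 1 := by
    have h1 := EuclideanSpace.norm_sq_eq x
    rw [hx1] at h1
    simpa [dotProduct, sq] using h1.symm
  have hsub : (φ • (Aᵀ * A + c • (1 : Matrix (Fin m) (Fin m) ℝ))
        - ((m - k : ℕ) : ℝ) • 1).submatrix (Subtype.val : S → Fin m) (Subtype.val : S → Fin m)
      = φ • (Aᵀ * A).submatrix (Subtype.val : S → Fin m) Subtype.val
        + (φ * c - ((m : ℝ) - k)) • (1 : Matrix S S ℝ) := by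
    ext a b
    rw [Nat.cast_sub hkm]
    simp only [Matrix.submatrix_apply, Matrix.sub_apply, Matrix.smul_apply, Matrix.add_apply,
      smul_eq_mul, Matrix.one_apply, Subtype.ext_iff]
    ring
  rw [hsub, Matrix.add_mulVec, Matrix.smul_mulVec, Matrix.smul_mulVec, Matrix.one_mulVec,
    dotProduct_add, dotProduct_smul, dotProduct_smul, hxx,
    ← norm_sq_toEuclideanLin_columnSubmatrix, smul_eq_mul, smul_eq_mul] at hquad
  rw [sub_le_iff_le_add, div_le_iff₀ hφ]
  linarith

end ColumnSelection

/-! ### Choice of the parameter `c` -/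

section Optimization

theorem card_sq_div_le_sum_inv {s : Finset ℕ} {x : ℕ → ℝ} (hx : ∀ i ∈ s, 0 < x i) :
    (s.card : ℝ) ^ 2 / ∑ i ∈ s, x i ≤ ∑ i ∈ s, (x i)⁻¹ := by
  refine div_le_of_le_mul₀ (Finset.sum_nonneg fun i hi => (hx i hi).le)
    (Finset.sum_nonneg fun i hi => (inv_pos.mpr (hx i hi)).le) ?_
  have h := Finset.sum_sq_le_sum_mul_sum_of_sq_le_mul s (r := fun _ => (1 : ℝ))
    (f := fun i => (x i)⁻¹) (g := x) (fun i hi => (inv_pos.mpr (hx i hi)).le)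
    (fun i hi => (hx i hi).le) fun i hi => by
      rw [inv_mul_cancel₀ (hx i hi).ne', one_pow]
  simpa using h

theorem mul_le_of_forall_pos_mul_sub_le {r k N Y : ℝ} (hk : 1 ≤ k) (hkr : k ≤ r) (hN : 0 < N)
    (hY : 0 ≤ Y) (h : ∀ c, 0 < c → c * (r ^ 2 / (r + c * N) - (k - 1)) ≤ Y) :
    (√r - √(k - 1)) ^ 2 * (r / N) ≤ Y := by
  have hr : 0 < r := by linarith
  rcases hk.eq_or_lt with rfl | hk1
  · rw [sub_self, Real.sqrt_zero, sub_zero, Real.sq_sqrt hr.le]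
    by_contra! hcon
    have hgap : 0 < r ^ 2 - Y * N := by
      rw [← mul_div_assoc, lt_div_iff₀ hN] at hcon
      linarith [sq r]
    -- For `k = 1` the supremum is only approached as `c → ∞`. The hypothesis amounts to `c (r² - Y
    -- N) ≤ Y r`, which this `c` violates by 1.
    have hc : 0 < (Y * r + 1) / (r ^ 2 - Y * N) := div_pos (by positivity) hgap
    have h1 := h _ hc
    have h2 : (Y * r + 1) / (r ^ 2 - Y * N) * (r ^ 2 - Y * N) = Y * r + 1 :=
      div_mul_cancel₀ _ hgap.ne'
    generalize (Y * r + 1) / (r ^ 2 - Y * N) = c at hc h1 h2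
    rw [sub_self, sub_zero, ← mul_div_assoc, div_le_iff₀ (by positivity)] at h1
    linarith
  · obtain ⟨a, ha⟩ : ∃ a, a = √r := ⟨_, rfl⟩
    obtain ⟨b, hb⟩ : ∃ b, b = √(k - 1) := ⟨_, rfl⟩
    have hbpos : 0 < b := hb ▸ Real.sqrt_pos.mpr (by linarith)
    have hab : b < a := ha ▸ hb ▸ Real.sqrt_lt_sqrt (by linarith) (by linarith)
    have hapos := hbpos.trans hab
    have hra : r = a ^ 2 := by rw [ha, Real.sq_sqrt hr.le]
    have hkb : k - 1 = b ^ 2 := by rw [hb, Real.sq_sqrt (by linarith)]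
    -- The maximizer in `c`: it makes `r² / (r + c N)` equal to `a b`, so the bound becomes `c b (a
    -- - b)`.
    have h1 := h ((a - b) / b * (r / N)) (by have := sub_pos.mpr hab; positivity)
    rw [← ha, ← hb]
    refine le_of_eq_of_le ?_ h1
    rw [hkb, hra]
    have h2 : a ^ 2 + (a - b) / b * (a ^ 2 / N) * N = a ^ 3 / b := by
      field_simp
      ring
    rw [h2]
    field_simp

end Optimization

/-! ### Assembling the restricted invertibility bound -/

section RestrictedInvertibility

variable {n m : ℕ} (A : Matrix (Fin n) (Fin m) ℝ)

theorem sum_inv_sq_sigma_pos {r : ℕ} (hr0 : 0 < r) (hr : r ≤ A.rank) :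
    0 < ∑ i ∈ Finset.range r, (sigma A i ^ 2)⁻¹ :=
  Finset.sum_pos (fun i hi => by
    have := (sigma_pos_iff A).mpr ((Finset.mem_range.mp hi).trans_le hr)
    positivity) (Finset.nonempty_range_iff.mpr hr0.ne')

theorem sum_inv_sq_sigma_add_le {r : ℕ} (hr : r ≤ A.rank) {c : ℝ} (hc : 0 < c) :
    ∑ i ∈ Finset.range m, (sigma A i ^ 2 + c)⁻¹
      ≤ (m - (r : ℝ) ^ 2 / (r + c * ∑ i ∈ Finset.range r, (sigma A i ^ 2)⁻¹)) / c := by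
  have hrm : r ≤ m := hr.trans A.rank_le_width
  have hσ : ∀ i ∈ Finset.range r, 0 < sigma A i := fun i hi =>
    (sigma_pos_iff A).mpr ((Finset.mem_range.mp hi).trans_le hr)
  have hhead : ∑ i ∈ Finset.range r, (sigma A i ^ 2 + c)⁻¹
      ≤ (r - (r : ℝ) ^ 2 / (r + c * ∑ i ∈ Finset.range r, (sigma A i ^ 2)⁻¹)) / c := by
    have h1 := card_sq_div_le_sum_inv (s := Finset.range r)
      (x := fun i => 1 + c * (sigma A i ^ 2)⁻¹) fun i hi => by
        have := hσ i hi
        positivity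
    rw [Finset.sum_add_distrib, ← Finset.mul_sum, Finset.sum_const, Finset.card_range,
      nsmul_one] at h1
    -- Rewriting through `1 + c σᵢ⁻²` makes the harmonic-arithmetic mean inequality `h1` produce
    -- exactly `∑ σᵢ⁻²`.
    have h2 : ∑ i ∈ Finset.range r, (sigma A i ^ 2 + c)⁻¹
        = (r - ∑ i ∈ Finset.range r, (1 + c * (sigma A i ^ 2)⁻¹)⁻¹) / c := by
      have h3 : (r : ℝ) = ∑ i ∈ Finset.range r, (1 : ℝ) := by simp
      rw [h3]
      rw [← Finset.sum_sub_distrib, Finset.sum_div]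
      refine Finset.sum_congr rfl fun i hi => ?_
      have := hσ i hi
      field_simp
      ring
    rw [h2]
    gcongr
  have htail : ∑ i ∈ Finset.Ico r m, (sigma A i ^ 2 + c)⁻¹ ≤ ((m : ℝ) - r) / c := by
    calc ∑ i ∈ Finset.Ico r m, (sigma A i ^ 2 + c)⁻¹ ≤ ∑ i ∈ Finset.Ico r m, c⁻¹ :=
          Finset.sum_le_sum fun i _ =>
            inv_anti₀ hc (le_add_of_nonneg_left (sq_nonneg _))
      _ = ((m : ℝ) - r) / c := by
          rw [Finset.sum_const, Nat.card_Ico, nsmul_eq_mul, Nat.cast_sub hrm, div_eq_mul_inv]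
  rw [← Finset.sum_range_add_sum_Ico _ hrm]
  refine (add_le_add hhead htail).trans (le_of_eq ?_)
  ring

theorem exists_finset_mul_sub_le_sigmaMin_sq {k r : ℕ} (hk : 1 ≤ k) (hkr : k ≤ r)
    (hr : r ≤ A.rank) {c : ℝ} (hc : 0 < c) :
    ∃ S : Finset (Fin m), S.card = k ∧
      c * ((r : ℝ) ^ 2 / (r + c * ∑ i ∈ Finset.range r, (sigma A i ^ 2)⁻¹) - (k - 1))
        ≤ sigmaMin (columnSubmatrix A S) ^ 2 * m := by
  have hrm : r ≤ m := hr.trans A.rank_le_width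
  have hN := sum_inv_sq_sigma_pos A (hk.trans hkr) hr
  have hsum := sum_inv_sq_sigma_add_le A hr hc
  generalize ∑ i ∈ Finset.range r, (sigma A i ^ 2)⁻¹ = N at hN hsum
  have hr0 : (0 : ℝ) < r := by exact_mod_cast hk.trans hkr
  have hrm' : (r : ℝ) ≤ m := by exact_mod_cast hrm
  obtain ⟨s, hs⟩ : ∃ s, s = (r : ℝ) ^ 2 / (r + c * N) := ⟨_, rfl⟩
  have hs0 : 0 < s := hs ▸ by positivity
  have hsr : s < r := by
    rw [hs, div_lt_iff₀ (by positivity)]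
    nlinarith [mul_pos hr0 (mul_pos hc hN)]
  rw [← hs] at hsum ⊢
  have hms : 0 < (m : ℝ) - s := by linarith
  obtain ⟨S, hS, hle⟩ := exists_finset_le_sigmaMin_sq A hc (div_pos hms hc) hsum hk (hkr.trans hrm)
  refine ⟨S, hS, ?_⟩
  have hX := sq_nonneg (sigmaMin (columnSubmatrix A S))
  rw [div_div_eq_mul_div, sub_le_iff_le_add, div_le_iff₀ hms] at hle
  nlinarith [mul_nonneg hX hs0.le]

/-- The subset found for a given `c` depends on `c`; a maximizing subset satisfies the bounds for
all `c` at once, as the limiting case `k = 1` requires. -/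
theorem exists_finset_card_eq_forall_sigmaMin_le {k : ℕ} (hk : k ≤ m) :
    ∃ S : Finset (Fin m), S.card = k ∧ ∀ T : Finset (Fin m), T.card = k →
      sigmaMin (columnSubmatrix A T) ^ 2 ≤ sigmaMin (columnSubmatrix A S) ^ 2 := by
  obtain ⟨S, hS, hmax⟩ := Finset.exists_max_image (Finset.powersetCard k Finset.univ)
    (fun T : Finset (Fin m) => sigmaMin (columnSubmatrix A T) ^ 2)
    (Finset.powersetCard_nonempty.mpr (by simpa using hk))
  exact ⟨S, (Finset.mem_powersetCard.mp hS).2, fun T hT =>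
    hmax T (Finset.mem_powersetCard.mpr ⟨Finset.subset_univ _, hT⟩)⟩

end RestrictedInvertibility

theorem corollary1p2 (n m : ℕ) (A : Matrix (Fin n) (Fin m) ℝ) (k r : ℕ)
    (hk : 1 ≤ k) (hkr : k ≤ r) (hr : r ≤ A.rank) :
    ∃ S : Finset (Fin m), S.card = k ∧
      (√(r : ℝ) - √((k : ℝ) - 1)) ^ 2 / (m : ℝ)
          * ((r : ℝ) / ∑ i ∈ Finset.range r, (sigma A i ^ 2)⁻¹)
        ≤ sigmaMin (columnSubmatrix A S) ^ 2 ∧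
      (r = A.rank →
        (√(A.rank : ℝ) - √((k : ℝ) - 1)) ^ 2 / (m : ℝ)
            * ((A.rank : ℝ) / ‖moorePenrose A‖ ^ 2)
          ≤ sigmaMin (columnSubmatrix A S) ^ 2) := by
  have hrm : r ≤ m := hr.trans A.rank_le_width
  have hm : (0 : ℝ) < m := by exact_mod_cast (hk.trans hkr).trans hrm
  have hN := sum_inv_sq_sigma_pos A (hk.trans hkr) hr
  obtain ⟨S, hS, hmax⟩ := exists_finset_card_eq_forall_sigmaMin_le A (hkr.trans hrm)
  have hmain : (√(r : ℝ) - √((k : ℝ) - 1)) ^ 2 / (m : ℝ)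
      * ((r : ℝ) / ∑ i ∈ Finset.range r, (sigma A i ^ 2)⁻¹)
        ≤ sigmaMin (columnSubmatrix A S) ^ 2 := by
    rw [div_mul_eq_mul_div, div_le_iff₀ hm]
    refine mul_le_of_forall_pos_mul_sub_le (by exact_mod_cast hk) (by exact_mod_cast hkr) hN
      (by positivity) fun c hc => ?_
    obtain ⟨T, hT, hle⟩ := exists_finset_mul_sub_le_sigmaMin_sq A hk hkr hr hc
    exact hle.trans (mul_le_mul_of_nonneg_right (hmax T hT) hm.le)
  refine ⟨S, hS, hmain, ?_⟩
  rintro rfl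
  refine le_trans ?_ hmain
  gcongr
  exact sum_inv_sq_sigma_le_frobenius_norm_sq
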